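/- Let $n\ge 2$ be an integer and $D=\{0,1,2\}$. For a sequence $\mathbf t=(t_k)_{k\ge 1}$ in $D$ put $\Phi(\mathbf t)=\sum_{k\ge 1} t_k 3^{-k}\in[0,1]$, and for $1\le i\le n$ put $$x_i(\mathbf t)=\sum_{j=0}^{\infty}\frac{\xi^{S_{i+jn}(\mathbf t)}(t_{i+jn})}{3^{j+1}},\qquad S_{i+jn}(\mathbf t)=\sum_{k=1}^{i+jn}t_k-\sum_{s=0}^{j}t_{i+sn},$$ where $\xi:D\to D$, $\xi(a)=2-a$, and $\xi^m$ is the $m$-th iterate of $\xi$. The value $x_i(\mathbf t)$ depends only on $\Phi(\mathbf t)$, so that $x_i(\Phi(\mathbf t)):=x_i(\mathbf t)$ defines functions $x_i:[0,1]\to[0,1]$, $1\le i\le n$: the coordinate functions of the $n$-dimensional Peano curve $t\mapsto(x_1(t),\dots,x_n(t))$. A function $f:[0,1]\to\mathbb R$ is called $q$-Hölder continuous at $t\in[0,1]$ if there are $C,\delta>0$ such that $|f(t)-f(t')|\le C|t-t'|^q$ for all $t'\in[0,1]$ with $|t-t'|<\delta$. Then, for every $i\in\{1,\dots,n\}$: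 (i) For every real $q>1/n$, $x_i$ is $q$-Hölder continuous at no point of $[0,1]$. In particular, $x_i$ is differentiable at no point of $[0,1]$ (at the endpoints, one-sided differentiability is meant). (ii) The Hausdorff dimension and the packing dimension of the graph $\{(t,x_i(t)) : t\in[0,1]\}\subset\mathbb R^2$ are both equal to $2-1/n$. -/

import Mathlib

open scoped ENNReal NNReal

namespace PeanoCurve

/-! ### The coordinate functions of the `n`-dimensional Peano curve

A ternary sequence `(t_1, t_2, …)` is a function `t : ℕ → Fin 3`, with `t k` standing for `t_{k+1}`;
the coordinates are indexed by `i : Fin n`, with `i` standing for the `(i+1)`-st coordinate.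
With these indices, row `i` of the matrix of `t` consists of the digits `t (i + j * n)`, `j ≥ 0`. -/

/-- The involution `ξ(a) = 2 - a` of `D = {0, 1, 2}`. -/
def xi (a : Fin 3) : Fin 3 := 2 - a

/-- The sum of all digits up to position `i + j * n` (included) minus the sum of the digits
number `0, …, j` of row `i`. The second sum runs over a part of the first,
so that the subtraction of natural numbers is not truncated (see `digitSum_add`). -/
def digitSum (n : ℕ) (i : Fin n) (j : ℕ) (t : ℕ → Fin 3) : ℕ :=
  (∑ k ∈ Finset.range (i + j * n + 1), (t k : ℕ)) - ∑ s ∈ Finset.range (j + 1), (t (i + s * n) : ℕ)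

/-- The `j`-th ternary digit of the `i`-th coordinate, `ξ^{S}(t_{i + j n})`. -/
def coordDigit (n : ℕ) (i : Fin n) (t : ℕ → Fin 3) (j : ℕ) : Fin 3 :=
  xi^[digitSum n i j t] (t (i + j * n))

/-- The `i`-th coordinate as a function of ternary sequences,
`x_i(t) = ∑_{j ≥ 0} ξ^{S}(t_{i + j n}) / 3 ^ (j + 1)`. -/
noncomputable def coordSeq (n : ℕ) (i : Fin n) (t : ℕ → Fin 3) : ℝ :=
  ∑' j : ℕ, ((coordDigit n i t j : ℕ) : ℝ) / 3 ^ (j + 1)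

/-- The map `Φ(t) = ∑_{k ≥ 0} t_k / 3 ^ (k + 1)` from ternary sequences to `[0, 1]`. -/
noncomputable def ternary (t : ℕ → Fin 3) : ℝ :=
  ∑' k : ℕ, ((t k : ℕ) : ℝ) / 3 ^ (k + 1)

open Classical in
/-- The `i`-th coordinate function `x_i` of the `n`-dimensional Peano curve: `x_i(τ) = x_i(t)` for any
ternary representation `t` of `τ ∈ [0, 1]`. The value does not depend on the representation
(see `coord_ternary`). Outside `[0, 1]` the value is the irrelevant `0`. -/
noncomputable def coord (n : ℕ) (i : Fin n) (τ : ℝ) : ℝ :=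
  if h : ∃ t : ℕ → Fin 3, ternary t = τ then coordSeq n i h.choose else 0

/-! ### The coordinate functions are well defined -/

theorem ternary_eq_ofDigits (t : ℕ → Fin 3) : ternary t = Real.ofDigits t := by
  simp [ternary, Real.ofDigits, Real.ofDigitsTerm, div_eq_mul_inv]

theorem coordSeq_eq_ternary (n : ℕ) (i : Fin n) (t : ℕ → Fin 3) :
    coordSeq n i t = ternary (coordDigit n i t) := rfl

theorem exists_ternary {τ : ℝ} (hτ : τ ∈ Set.Icc (0 : ℝ) 1) : ∃ t : ℕ → Fin 3, ternary t = τ := by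
  obtain ⟨t, -, ht⟩ := Real.ofDigits_SurjOn (b := 3) (by norm_num) hτ
  exact ⟨t, by rw [ternary_eq_ofDigits, ht]⟩

theorem xi_iterate (m : ℕ) (a : Fin 3) : xi^[m] a = if Even m then a else xi a := by
  induction m with
  | zero => simp
  | succ m ih =>
    rw [Function.iterate_succ_apply', ih]
    by_cases h : Even m
    · simp [h, Nat.even_add_one]
    · simp only [h, if_false, Nat.even_add_one, not_false_eq_true, if_true]
      clear ih h
      revert a; decide

theorem digitSum_add (n : ℕ) (i : Fin n) (j : ℕ) (t : ℕ → Fin 3) :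
    digitSum n i j t + ∑ s ∈ Finset.range (j + 1), (t (i + s * n) : ℕ) =
      ∑ k ∈ Finset.range (i + j * n + 1), (t k : ℕ) := by
  have hn : 0 < n := i.pos
  have hinj : Set.InjOn (fun s : ℕ => (i : ℕ) + s * n) (Finset.range (j + 1)) := by
    intro a _ b _ hab
    exact Nat.eq_of_mul_eq_mul_right hn (by simpa using hab)
  refine Nat.sub_add_cancel ?_
  rw [← Finset.sum_image (f := fun k => (t k : ℕ)) hinj]
  refine Finset.sum_le_sum_of_subset ?_
  intro k hk
  simp only [Finset.mem_image, Finset.mem_range] at hk ⊢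
  obtain ⟨s, hs, rfl⟩ := hk
  have : s * n ≤ j * n := Nat.mul_le_mul_right n (by omega)
  omega

theorem digitSum_eq (n : ℕ) (i : Fin n) (j : ℕ) (t : ℕ → Fin 3) :
    digitSum n i j t = ∑ k ∈ Finset.range (i + j * n) with k % n ≠ i, (t k : ℕ) := by
  have hn : 0 < n := i.pos
  have hinj : Set.InjOn (fun s : ℕ => (i : ℕ) + s * n) (Finset.range (j + 1)) := by
    intro a _ b _ hab
    exact Nat.eq_of_mul_eq_mul_right hn (by simpa using hab)
  have h := digitSum_add n i j t
  rw [← Finset.sum_image (f := fun k => (t k : ℕ)) hinj,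
    ← Finset.sum_filter_add_sum_filter_not (Finset.range (i + j * n + 1)) (fun k => k % n ≠ i)] at h
  have h1 : (Finset.range (j + 1)).image (fun s : ℕ => (i : ℕ) + s * n) =
      {k ∈ Finset.range (i + j * n + 1) | ¬ (k % n ≠ i)} := by
    ext k
    simp only [Finset.mem_image, Finset.mem_range, Finset.mem_filter, not_not]
    constructor
    · rintro ⟨s, hs, rfl⟩
      have : s * n ≤ j * n := Nat.mul_le_mul_right n (by omega)
      exact ⟨by omega, by simp [Nat.mod_eq_of_lt i.isLt]⟩
    · rintro ⟨hk, hm⟩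
      have hd := Nat.mod_add_div' k n
      refine ⟨k / n, ?_, by omega⟩
      have : k / n * n < (j + 1) * n := by
        have := i.isLt
        rw [add_mul]; omega
      exact Nat.lt_of_mul_lt_mul_right this
  have h2 : {k ∈ Finset.range (i + j * n + 1) | k % n ≠ i} =
      {k ∈ Finset.range (i + j * n) | k % n ≠ i} := by
    rw [Finset.range_add_one, Finset.filter_insert]
    simp [Nat.mod_eq_of_lt i.isLt]
  rw [h1, h2] at h
  exact Nat.add_right_cancel h

theorem ternary_split (t : ℕ → Fin 3) (p : ℕ) :
    ternary t = (∑ k ∈ Finset.range p, ((t k : ℕ) : ℝ) / 3 ^ (k + 1)) +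
      ((t p : ℕ) + ternary (fun k => t (k + (p + 1)))) / 3 ^ (p + 1) := by
  rw [ternary_eq_ofDigits, ternary_eq_ofDigits, Real.ofDigits_eq_sum_add_ofDigits t (p + 1),
    Finset.sum_range_succ]
  simp only [Real.ofDigitsTerm, div_eq_mul_inv]
  push_cast
  ring

theorem ternary_xi (t : ℕ → Fin 3) : ternary (fun k => xi (t k)) = 1 - ternary t := by
  have h : ternary (fun k => xi (t k)) + ternary t = 1 := by
    rw [← Real.ofDigits_const_last_eq_one 2, ternary_eq_ofDigits, ternary_eq_ofDigits]
    simp only [Real.ofDigits]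
    rw [← Summable.tsum_add Real.summable_ofDigitsTerm Real.summable_ofDigitsTerm]
    refine tsum_congr fun k => ?_
    simp only [Real.ofDigitsTerm, ← add_mul]
    congr 1
    generalize t k = a
    have ha : ((xi a : Fin 3) : ℕ) + (a : ℕ) = 2 := by revert a; decide
    have ha' : (((xi a : Fin 3) : ℕ) : ℝ) + ((a : ℕ) : ℝ) = 2 := by exact_mod_cast ha
    simpa using ha'
  linarith

theorem eq_zero_of_ternary {t : ℕ → Fin 3} (h : ternary t ≤ 0) (k : ℕ) : t k = 0 := by
  rw [ternary_eq_ofDigits] at h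
  have h0 := (hasSum_zero_iff_of_nonneg (fun k => Real.ofDigitsTerm_nonneg (digits := t) (n := k))).1
    (by
      have := (Real.summable_ofDigitsTerm (digits := t)).hasSum
      rwa [show ∑' k, Real.ofDigitsTerm t k = 0 from le_antisymm h (Real.ofDigits_nonneg t)] at this)
  have hk := congrFun h0 k
  simp only [Real.ofDigitsTerm, Pi.zero_apply, mul_eq_zero, inv_eq_zero] at hk
  rcases hk with hk | hk
  · exact Fin.ext (Nat.cast_eq_zero.1 hk)
  · exact absurd hk (by positivity)

theorem eq_two_of_ternary {t : ℕ → Fin 3} (h : 1 ≤ ternary t) (k : ℕ) : t k = 2 := by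
  have := eq_zero_of_ternary (t := fun k => xi (t k)) (by rw [ternary_xi]; linarith) k
  simp only [xi] at this
  generalize t k = a at this
  revert a; decide

theorem digitSum_parity (n : ℕ) (i : Fin n) (j p : ℕ) (t u : ℕ → Fin 3)
    (hp : (t p : ℕ) = u p + 1) (hne : ∀ k ≠ p, ((t k : ℕ) + u k) % 2 = 0) :
    (Even (digitSum n i j t) ↔ Even (digitSum n i j u)) ↔ ¬ (p < i + j * n ∧ p % n ≠ i) := by
  have key : (digitSum n i j t + digitSum n i j u) % 2 =
      if p < i + j * n ∧ p % n ≠ i then 1 else 0 := by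
    rw [digitSum_eq, digitSum_eq, ← Finset.sum_add_distrib, Finset.sum_nat_mod]
    rw [Finset.sum_congr rfl (g := fun k => if k = p then 1 else 0) ?_]
    · rw [Finset.sum_ite_eq']
      simp only [Finset.mem_filter, Finset.mem_range]
      split_ifs <;> rfl
    · intro k _
      split_ifs with hk
      · subst hk; omega
      · exact hne k hk
  simp only [Nat.even_iff]
  split_ifs at key with h
  · simp only [h, ne_eq, not_false_eq_true, and_self, not_true_eq_false, iff_false]; omega
  · simp only [h, not_false_eq_true, iff_true]; omega

/-- Two different ternary representations of the same number give the same coordinates,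
the sequences being `(…, a + 1, 0, 0, …)` and `(…, a, 2, 2, …)`. -/
theorem coordSeq_eq_aux (n : ℕ) (i : Fin n) (p : ℕ) (t u : ℕ → Fin 3)
    (hlt : ∀ k < p, t k = u k) (hp : (t p : ℕ) = u p + 1)
    (ht : ∀ k, p < k → t k = 0) (hu : ∀ k, p < k → u k = 2) :
    coordSeq n i t = coordSeq n i u := by
  have hn : 0 < n := i.pos
  have hne : ∀ k ≠ p, ((t k : ℕ) + u k) % 2 = 0 := by
    intro k hk
    rcases lt_or_gt_of_ne hk with h | h
    · rw [hlt k h]; omega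
    · rw [ht k h, hu k h]; rfl
  have par := fun j => digitSum_parity n i j p t u hp hne
  rw [coordSeq_eq_ternary, coordSeq_eq_ternary]
  by_cases hi : p % n = i
  · have hpeq : (i : ℕ) + p / n * n = p := by rw [← hi]; exact Nat.mod_add_div' p n
    have heq : ∀ j, (Even (digitSum n i j t) ↔ Even (digitSum n i j u)) := fun j =>
      (par j).2 (by simp [hi])
    have hbefore : ∀ j < p / n, coordDigit n i t j = coordDigit n i u j := by
      intro j hj
      have hlt' : (i : ℕ) + j * n < p := by
        have : j * n < p / n * n := Nat.mul_lt_mul_of_pos_right hj hn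
        omega
      simp only [coordDigit, xi_iterate, heq j, hlt _ hlt']
    have hS : ∀ j, p / n ≤ j → digitSum n i j t = digitSum n i (p / n) t := by
      intro j hj
      rw [digitSum_eq, digitSum_eq, hpeq]
      symm
      have hle : p ≤ i + j * n := by
        have : p / n * n ≤ j * n := Nat.mul_le_mul_right n hj
        omega
      refine Finset.sum_subset (Finset.filter_subset_filter _ (Finset.range_mono hle)) ?_
      intro k hk hk'
      simp only [Finset.mem_filter, Finset.mem_range, not_and_or, not_lt] at hk hk'
      rcases hk' with h | h
      · have : k ≠ p := by rintro rfl; exact hk.2 hi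
        rw [ht k (by omega)]; rfl
      · exact absurd hk.2 h
    have hafter : ∀ j, p < (i : ℕ) + (j + (p / n + 1)) * n := by
      intro j
      have : (j + (p / n + 1)) * n = j * n + p / n * n + n := by ring
      omega
    have h01 : ternary (fun _ => (0 : Fin 3)) = 0 := by simp [ternary]
    have h21 : ternary (fun _ => (2 : Fin 3)) = 1 := by
      have := ternary_xi (fun _ => (0 : Fin 3))
      rw [h01] at this
      simpa [xi] using this
    rw [ternary_split _ (p / n), ternary_split (coordDigit n i u) (p / n)]
    congr 1
    · exact Finset.sum_congr rfl fun j hj => by rw [hbefore j (Finset.mem_range.1 hj)]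
    · congr 1
      by_cases hE : Even (digitSum n i (p / n) t)
      · have e1 : (fun k => coordDigit n i t (k + (p / n + 1))) = fun _ => 0 := by
          funext j
          simp only [coordDigit, xi_iterate, hS (j + (p / n + 1)) (by omega), hE, if_true,
            ht _ (hafter j)]
        have e2 : (fun k => coordDigit n i u (k + (p / n + 1))) = fun _ => 2 := by
          funext j
          simp only [coordDigit, xi_iterate, ← heq, hS (j + (p / n + 1)) (by omega), hE, if_true,
            hu _ (hafter j)]
        rw [e1, e2, h01, h21]
        simp only [coordDigit, xi_iterate, ← heq, hE, if_true, hpeq, hp]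
        push_cast; ring
      · have e1 : (fun k => coordDigit n i t (k + (p / n + 1))) = fun _ => 2 := by
          funext j
          simp only [coordDigit, xi_iterate, hS (j + (p / n + 1)) (by omega), hE, if_false,
            ht _ (hafter j)]
          rfl
        have e2 : (fun k => coordDigit n i u (k + (p / n + 1))) = fun _ => 0 := by
          funext j
          simp only [coordDigit, xi_iterate, ← heq, hS (j + (p / n + 1)) (by omega), hE, if_false,
            hu _ (hafter j)]
          rfl
        rw [e1, e2, h01, h21]
        simp only [coordDigit, xi_iterate, ← heq, hE, if_false, hpeq]
        have hx : ((xi (u p) : Fin 3) : ℕ) = xi (t p) + 1 := by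
          revert hp
          generalize t p = a
          generalize u p = b
          revert a b; decide
        rw [hx]
        push_cast; ring
  · congr 1
    funext j
    simp only [coordDigit, xi_iterate]
    rcases lt_or_ge p (i + j * n) with h | h
    · have hpar : ¬ (Even (digitSum n i j t) ↔ Even (digitSum n i j u)) := by
        rw [par j]; simp [h, hi]
      rw [ht _ h, hu _ h]
      by_cases h1 : Even (digitSum n i j t) <;> by_cases h2 : Even (digitSum n i j u)
      · exact absurd (by simp [h1, h2]) hpar
      · simp [h1, h2, xi]
      · simp [h1, h2, xi]
      · exact absurd (by simp [h1, h2]) hpar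
    · have hne' : (i : ℕ) + j * n ≠ p := by
        rintro rfl
        exact hi (by simp [Nat.mod_eq_of_lt i.isLt])
      have hpar := (par j).2 (by omega)
      rw [hlt _ (by omega)]
      simp only [hpar]

theorem coordSeq_congr (n : ℕ) (i : Fin n) {t u : ℕ → Fin 3} (h : ternary t = ternary u) :
    coordSeq n i t = coordSeq n i u := by
  classical
  have main : ∀ (t u : ℕ → Fin 3) (p : ℕ), ternary t = ternary u → (∀ k < p, t k = u k) →
      (u p : ℕ) < t p → coordSeq n i t = coordSeq n i u := by
    intro t u p h hlt hp
    rw [ternary_split t p, ternary_split u p, Finset.sum_congr rfl (fun k hk => by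
      rw [hlt k (Finset.mem_range.1 hk)])] at h
    have h3 : (0 : ℝ) < 3 ^ (p + 1) := by positivity
    have h' := (div_left_inj' h3.ne').1 (add_left_cancel h)
    have b1 : 0 ≤ ternary (fun k => t (k + (p + 1))) := by
      rw [ternary_eq_ofDigits]; exact Real.ofDigits_nonneg _
    have b2 : ternary (fun k => u (k + (p + 1))) ≤ 1 := by
      rw [ternary_eq_ofDigits]; exact Real.ofDigits_le_one _
    have hp1 : ((u p : ℕ) : ℝ) + 1 ≤ (t p : ℕ) := by exact_mod_cast hp
    have htz := eq_zero_of_ternary (t := fun k => t (k + (p + 1))) (by linarith)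
    have hut := eq_two_of_ternary (t := fun k => u (k + (p + 1))) (by linarith)
    have hp2 : ((t p : ℕ) : ℝ) = (u p : ℕ) + 1 := by linarith
    refine coordSeq_eq_aux n i p t u hlt (by exact_mod_cast hp2) ?_ ?_
    · intro k hk
      have := htz (k - (p + 1))
      rwa [Nat.sub_add_cancel (by omega)] at this
    · intro k hk
      have := hut (k - (p + 1))
      rwa [Nat.sub_add_cancel (by omega)] at this
  by_cases htu : t = u
  · rw [htu]
  have hex : ∃ k, t k ≠ u k := Function.ne_iff.1 htu
  have hlt : ∀ k < Nat.find hex, t k = u k := fun k hk => not_not.1 (Nat.find_min hex hk)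
  have hne : (t (Nat.find hex) : ℕ) ≠ u (Nat.find hex) := fun e => Nat.find_spec hex (Fin.ext e)
  rcases lt_or_gt_of_ne hne with h1 | h1
  · exact (main u t _ h.symm (fun k hk => (hlt k hk).symm) h1).symm
  · exact main t u _ h hlt h1

/-- The defining property of the coordinate functions: `x_i(Φ(t)) = x_i(t)` for every `t`. -/
theorem coord_ternary (n : ℕ) (i : Fin n) (t : ℕ → Fin 3) :
    coord n i (ternary t) = coordSeq n i t := by
  have h : ∃ u : ℕ → Fin 3, ternary u = ternary t := ⟨t, rfl⟩
  rw [coord, dif_pos h]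
  exact coordSeq_congr n i h.choose_spec

/-! ### Hölder continuity at a point, graphs -/

/-- `f` is `q`-Hölder continuous at the point `a` of the interval `I`: there are `C, δ > 0` such that
`|f a - f b| ≤ C |a - b| ^ q` for all `b ∈ I` with `|a - b| < δ`. -/
def IsHolderAt (f : ℝ → ℝ) (I : Set ℝ) (q a : ℝ) : Prop :=
  ∃ C > 0, ∃ δ > 0, ∀ b ∈ I, |a - b| < δ → |f a - f b| ≤ C * |a - b| ^ q

/-- The graph of the restriction of `f` to `I`, a subset of the Euclidean plane. -/
def graph (f : ℝ → ℝ) (I : Set ℝ) : Set (EuclideanSpace ℝ (Fin 2)) :=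
  (fun a : ℝ => !₂[a, f a]) '' I

/-! ### Packing measure and packing dimension -/

section Packing

variable {X : Type*} [PseudoMetricSpace X]

/-- A finite `δ`-packing of `A`, as a finite set of pairs `(x, r)` of centres and radii: the closed
balls `B(x, r)` have centres in `A` and radii `0 < r ≤ δ`, and are pairwise disjoint. -/
def IsPacking (δ : ℝ) (A : Set X) (P : Finset (X × ℝ)) : Prop :=
  (∀ b ∈ P, b.1 ∈ A ∧ 0 < b.2 ∧ b.2 ≤ δ) ∧
    (P : Set (X × ℝ)).PairwiseDisjoint fun b => Metric.closedBall b.1 b.2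

/-- The `s`-dimensional packing premeasure: the limit (= infimum) as `δ → 0` of the supremum of
`∑ (2 r) ^ s` over all `δ`-packings of `A`. (Finite packings give the same supremum as
countable ones.) -/
noncomputable def packingPremeasure (s : ℝ≥0) (A : Set X) : ℝ≥0∞ :=
  ⨅ (δ : ℝ) (_ : 0 < δ), ⨆ (P : Finset (X × ℝ)) (_ : IsPacking δ A P),
    ∑ b ∈ P, ENNReal.ofReal ((2 * b.2) ^ (s : ℝ))

/-- The `s`-dimensional packing measure: the infimum of `∑ₖ P₀ˢ(Bₖ)` over all countable covers
`(Bₖ)` of `A`, where `P₀ˢ` is the packing premeasure. -/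
noncomputable def packingMeasure (s : ℝ≥0) (A : Set X) : ℝ≥0∞ :=
  ⨅ (B : ℕ → Set X) (_ : A ⊆ ⋃ k, B k), ∑' k, packingPremeasure s (B k)

/-- The packing dimension: the supremum of all `s ≥ 0` such that the `s`-dimensional packing measure
of `A` is infinite. -/
noncomputable def packingDim (A : Set X) : ℝ≥0∞ :=
  ⨆ (s : ℝ≥0) (_ : packingMeasure s A = ∞), (s : ℝ≥0∞)

end Packing

end PeanoCurve

/-!
The sign of a digit of the `i`-th coordinate `x_i` is determined by the digits of the argument outside
row `i`. Two consequences carry the proof.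

*Hölder exponents.* Changing one digit of the argument in row `i`, at position `i + k * n`, changes one
single digit of `x_i`, the `k`-th. So within distance `3 ^ (-k * n)` of every point there is another one
at which `x_i` differs by at least `3 ^ (-(k + 1))` (`exists_near_far`). This rules out every exponent
`q > 1 / n`, and differentiability, which would give the exponent `1`.

*Dimensions.* Replacing the digits of row `i` by the digits of `x_i` is an involution on the ternary
sequences (`twist`). Parametrizing the graph by the twisted sequence `y` makes both coordinates of a
point explicit: the argument has the digits `twist n i y`, and `x_i` has the digits of `y` in row `i`
(`graphPoint`). Knowing a point of the graph up to `ρ = 3 ^ (-k * n)` is, up to bounded ambiguity,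
knowing the first `k * n` digits of the argument, hence of `y`, and the first `k * n` digits of row `i`.
The two groups have `k` digits in common, so these are `2 * k * n - k` digits of `y`, and the uniform
measure gives such a cylinder the mass `3 ^ (-(2 * k * n - k)) = ρ ^ (2 - 1 / n)`.
The image measure on the graph is therefore Ahlfors regular of dimension `s = 2 - 1 / n`: sets of
diameter `r` have mass at most `C * r ^ s` (`graphMeasure_le`), and balls of radius `r` about points of
the graph have mass at least `c * r ^ s` (`le_graphMeasure_closedBall`). The first bound gives
`s ≤ dimH` by the mass distribution principle. The second bounds all packing sums of exponent `s`, so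
that `packingDim ≤ s`. Together with the general inequality `dimH_le_packingDim` both dimensions are `s`.
-/

namespace PeanoCurve

open MeasureTheory Filter Topology

/-! ### Hausdorff and packing dimension in a metric space -/

section Packing

variable {X : Type*} [MetricSpace X]

/-- A maximal `2δ`-separated subset of `B` is the set of centres of a packing by balls of radius `δ`,
and the balls of radius `2δ` about its points cover `B`. It is finite because arbitrarily large separated
subsets would make the packing sums unbounded. -/
theorem exists_cover_card_mul_le (s : ℝ≥0) (B : Set X) {δ : ℝ≥0} (hδ : 0 < δ)
    (hfin : (⨆ (P : Finset (X × ℝ)) (_ : IsPacking δ B P),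
      ∑ b ∈ P, ENNReal.ofReal ((2 * b.2) ^ (s : ℝ))) ≠ ∞) :
    ∃ C : Finset X, B ⊆ ⋃ x ∈ C, Metric.closedBall x (2 * δ) ∧
      C.card * ENNReal.ofReal ((2 * δ : ℝ) ^ (s : ℝ)) ≤
        ⨆ (P : Finset (X × ℝ)) (_ : IsPacking δ B P),
          ∑ b ∈ P, ENNReal.ofReal ((2 * b.2) ^ (s : ℝ)) := by
  classical
  have hδ' : (0 : ℝ) < δ := hδ
  have key : ∀ C : Finset X, (C : Set X) ⊆ B → Metric.IsSeparated (2 * δ : ℝ≥0) (C : Set X) →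
      C.card * ENNReal.ofReal ((2 * δ : ℝ) ^ (s : ℝ)) ≤
        ⨆ (P : Finset (X × ℝ)) (_ : IsPacking δ B P),
          ∑ b ∈ P, ENNReal.ofReal ((2 * b.2) ^ (s : ℝ)) := by
    intro C hCB hC
    have hinj : Function.Injective (fun x : X => (x, (δ : ℝ))) := fun x y h => (Prod.ext_iff.1 h).1
    have hP : IsPacking δ B (C.map ⟨_, hinj⟩) := by
      constructor
      · intro b hb
        obtain ⟨x, hx, rfl⟩ := Finset.mem_map.1 hb
        exact ⟨hCB hx, hδ', le_rfl⟩
      · intro b hb c hc hbc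
        obtain ⟨x, hx, rfl⟩ := Finset.mem_map.1 (Finset.mem_coe.1 hb)
        obtain ⟨y, hy, rfl⟩ := Finset.mem_map.1 (Finset.mem_coe.1 hc)
        have hxy : x ≠ y := fun h => hbc (by rw [h])
        have : ((2 * δ : ℝ≥0) : ℝ≥0∞) < edist x y := hC hx hy hxy
        rw [edist_nndist, ENNReal.coe_lt_coe, ← NNReal.coe_lt_coe, coe_nndist] at this
        refine Metric.closedBall_disjoint_closedBall ?_
        push_cast at this
        simp only [Function.Embedding.coeFn_mk]
        linarith
    refine le_trans (le_of_eq ?_) (le_iSup₂ (f := fun (P : Finset (X × ℝ)) (_ : IsPacking δ B P) =>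
      ∑ b ∈ P, ENNReal.ofReal ((2 * b.2) ^ (s : ℝ))) _ hP)
    simp
  have hpos : ENNReal.ofReal ((2 * δ : ℝ) ^ (s : ℝ)) ≠ 0 := by
    rw [Ne, ENNReal.ofReal_eq_zero, not_le]; positivity
  have hpack : Metric.packingNumber (2 * δ : ℝ≥0) B ≠ ⊤ := by
    intro htop
    refine hfin (ENNReal.eq_top_of_forall_nnreal_le fun r => ?_)
    obtain ⟨N, hN⟩ := ENNReal.exists_nat_mul_gt hpos (b := r) ENNReal.coe_ne_top
    have hlt : (N : ℕ∞) < Metric.packingNumber (2 * δ : ℝ≥0) B := by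
      rw [htop]; exact ENat.natCast_lt_top N
    simp only [Metric.packingNumber, lt_iSup_iff] at hlt
    obtain ⟨C, hCB, hC, hNC⟩ := hlt
    obtain ⟨D, hDC, hD⟩ := Set.exists_subset_encard_eq hNC.le
    have hDf : D.Finite := Set.finite_of_encard_eq_coe hD
    have hcard : hDf.toFinset.card = N := by
      rw [hDf.encard_eq_coe_toFinset_card] at hD; exact_mod_cast hD
    have := key hDf.toFinset (by simpa using hDC.trans hCB) (by simpa using hC.subset hDC)
    rw [hcard] at this
    exact hN.le.trans this
  obtain ⟨C, hCB, hCf, hC, hcard⟩ := Metric.exists_set_encard_eq_packingNumber hpack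
  refine ⟨hCf.toFinset, ?_, key _ (by simpa using hCB) (by simpa using hC)⟩
  intro x hx
  -- An uncovered point could be added to the maximal separated set `C`.
  by_contra hcon
  simp only [Set.mem_iUnion, Metric.mem_closedBall, not_exists, not_le, Set.Finite.mem_toFinset]
    at hcon
  have hxC : x ∉ C := fun h => by
    have := hcon x h
    rw [dist_self] at this
    linarith
  have hsep : Metric.IsSeparated (2 * δ : ℝ≥0) (insert x C) := by
    refine hC.insert fun y hy _ => ?_
    rw [edist_nndist, ENNReal.coe_lt_coe, ← NNReal.coe_lt_coe, coe_nndist]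
    simpa using hcon y hy
  have h1 := hsep.encard_le_packingNumber (Set.insert_subset hx hCB)
  rw [← hcard, Set.encard_insert_of_notMem hxC, hCf.encard_eq_coe_toFinset_card] at h1
  have h2 : hCf.toFinset.card + 1 ≤ hCf.toFinset.card := by exact_mod_cast h1
  omega

theorem IsPacking.mono {δ δ' : ℝ} {A : Set X} {P : Finset (X × ℝ)} (h : IsPacking δ A P)
    (hδ : δ ≤ δ') : IsPacking δ' A P :=
  ⟨fun b hb => ⟨(h.1 b hb).1, (h.1 b hb).2.1, (h.1 b hb).2.2.trans hδ⟩, h.2⟩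

/-- Up to a constant, the packing premeasure dominates the Hausdorff measure. -/
theorem hausdorffMeasure_le_packingPremeasure [MeasurableSpace X] [BorelSpace X] (s : ℝ≥0)
    (B : Set X) : ((2 : ℝ≥0∞) ^ (s : ℝ))⁻¹ * μH[s] B ≤ packingPremeasure s B := by
  have h2 : ((2 : ℝ≥0∞) ^ (s : ℝ)) ≠ 0 := by simp
  have h2' : ((2 : ℝ≥0∞) ^ (s : ℝ)) ≠ ∞ := by simp
  refine le_iInf₂ fun δ hδ => ?_
  rw [mul_comm, ← div_eq_mul_inv, ENNReal.div_le_iff h2 h2']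
  set Q := fun δ : ℝ => ⨆ (P : Finset (X × ℝ)) (_ : IsPacking δ B P),
    ∑ b ∈ P, ENNReal.ofReal ((2 * b.2) ^ (s : ℝ)) with hQ
  change _ ≤ Q δ * _
  by_cases hfin : Q δ = ∞
  · rw [hfin, ENNReal.top_mul h2]; exact le_top
  lift δ to ℝ≥0 using hδ.le
  -- Covers by balls of radius `2 * d m`, with `d m → 0`, whose sums stay below `2 ^ s * Q δ`.
  let d : ℕ → ℝ≥0 := fun m => δ / (m + 1)
  have hd : ∀ m, 0 < d m := fun m => div_pos hδ (by positivity)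
  have hdδ : ∀ m, d m ≤ δ := fun m => div_le_self zero_le (by simp)
  have hQd : ∀ m, Q (d m) ≤ Q δ := fun m => biSup_mono fun P hP => hP.mono (hdδ m)
  choose C hC1 hC2 using fun m =>
    exists_cover_card_mul_le s B (hd m) (ne_top_of_le_ne_top hfin (hQd m))
  have hd0 : Tendsto (fun m => (d m : ℝ≥0∞)) atTop (𝓝 0) := by
    rw [← ENNReal.coe_zero, ENNReal.tendsto_coe, ← NNReal.tendsto_coe]
    have : Tendsto (fun m : ℕ => (m : ℝ) + 1) atTop atTop :=
      tendsto_atTop_add_const_right _ _ tendsto_natCast_atTop_atTop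
    simpa [d] using tendsto_const_nhds.div_atTop this
  have hdiam : ∀ (m : ℕ) (x : X),
      Metric.ediam (Metric.closedBall x (2 * d m : ℝ)) ≤ 2 * (2 * d m) := by
    intro m x
    rw [← Metric.closedEBall_ofReal (by positivity)]
    refine Metric.ediam_closedEBall_le.trans (le_of_eq ?_)
    rw [ENNReal.ofReal_mul (by norm_num), ENNReal.ofReal_coe_nnreal]
    simp
  have hmain := Measure.hausdorffMeasure_le_liminf_sum (ι := fun m => C m) (s : ℝ) B (l := atTop)
    (fun m => 2 * (2 * (d m : ℝ≥0∞)))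
    (by
      have := ENNReal.Tendsto.const_mul (a := 2 * 2) hd0 (Or.inr (by finiteness))
      simpa [mul_assoc] using this)
    (fun m x => Metric.closedBall (x : X) (2 * d m))
    (Eventually.of_forall fun m x => hdiam m x)
    (Eventually.of_forall fun m => by
      refine (hC1 m).trans fun x hx => ?_
      simpa using hx)
  refine hmain.trans (liminf_le_of_le (by isBoundedDefault) fun b hb => ?_)
  obtain ⟨m, hm⟩ := hb.exists
  refine hm.trans (le_trans ?_ (mul_le_mul_left ((hC2 m).trans (hQd m)) _))
  calc ∑ x : C m, Metric.ediam (Metric.closedBall (x : X) (2 * d m)) ^ (s : ℝ)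
      ≤ ∑ _x : C m, (2 * (2 * (d m : ℝ≥0∞))) ^ (s : ℝ) :=
        Finset.sum_le_sum fun x _ => ENNReal.rpow_le_rpow (hdiam m x) s.2
    _ = _ := by
      rw [Finset.sum_const, Finset.card_univ, Fintype.card_coe, nsmul_eq_mul,
        ENNReal.mul_rpow_of_nonneg 2 _ s.coe_nonneg, mul_assoc, mul_comm ((2 : ℝ≥0∞) ^ (s : ℝ)),
        ← ENNReal.ofReal_rpow_of_nonneg (by positivity) s.coe_nonneg, ENNReal.ofReal_mul (by norm_num),
        ENNReal.ofReal_coe_nnreal]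
      simp

theorem dimH_le_packingDim (A : Set X) : dimH A ≤ packingDim A := by
  borelize X
  refine dimH_le fun s hs => le_iSup₂_of_le (f := fun (s : ℝ≥0) (_ : packingMeasure s A = ∞) =>
    (s : ℝ≥0∞)) s ?_ le_rfl
  rw [packingMeasure, iInf₂_eq_top]
  intro B hB
  have h2 : ((2 : ℝ≥0∞) ^ (s : ℝ))⁻¹ ≠ 0 := by simp
  have : ((2 : ℝ≥0∞) ^ (s : ℝ))⁻¹ * μH[s] A ≤ ∑' k, packingPremeasure s (B k) := by
    calc _ ≤ ((2 : ℝ≥0∞) ^ (s : ℝ))⁻¹ * ∑' k, μH[s] (B k) := by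
          gcongr
          exact (measure_mono hB).trans (measure_iUnion_le B)
      _ = ∑' k, ((2 : ℝ≥0∞) ^ (s : ℝ))⁻¹ * μH[s] (B k) := ENNReal.tsum_mul_left.symm
      _ ≤ _ := ENNReal.tsum_le_tsum fun k => hausdorffMeasure_le_packingPremeasure s (B k)
  rwa [hs, ENNReal.mul_top h2, top_le_iff] at this

theorem packingPremeasure_empty (s : ℝ≥0) : packingPremeasure s (∅ : Set X) = 0 := by
  refine le_antisymm (iInf₂_le_of_le 1 one_pos (iSup₂_le fun P hP => ?_)) zero_le
  have : P = ∅ := Finset.eq_empty_of_forall_notMem fun b hb => (hP.1 b hb).1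
  simp [this]

/-- If a finite measure gives mass at least `c r ^ s` to every small ball of radius `r` centred
in `A`, then the packing sums of `A` are bounded, as disjoint balls share the total mass. -/
theorem packingDim_le_of_le_measure_closedBall [MeasurableSpace X] [OpensMeasurableSpace X]
    (ν : Measure X) [IsFiniteMeasure ν] (A : Set X) (s c : ℝ≥0) (hc : c ≠ 0) {δ : ℝ} (hδ : 0 < δ)
    (h : ∀ x ∈ A, ∀ r : ℝ, 0 < r → r ≤ δ →
      c * ENNReal.ofReal ((2 * r) ^ (s : ℝ)) ≤ ν (Metric.closedBall x r)) :
    packingDim A ≤ s := by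
  refine iSup₂_le fun u hu => ?_
  by_contra! hsu
  have hsu' : s < u := by exact_mod_cast hsu
  refine absurd hu (ne_top_of_le_ne_top (b := ν Set.univ / c) ?_ ?_)
  · exact ENNReal.div_ne_top (measure_ne_top _ _) (by simpa using hc)
  refine iInf₂_le_of_le (fun k => if k = 0 then A else ∅)
    (fun x hx => Set.mem_iUnion.2 ⟨0, by simpa using hx⟩) ?_
  rw [tsum_eq_single 0 (fun k hk => by simp [hk, packingPremeasure_empty])]
  -- Radii at most `1 / 2` ensure `(2 * r) ^ u ≤ (2 * r) ^ s` for the exponent `u > s`.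
  refine iInf₂_le_of_le (min δ (1 / 2)) (by positivity) (iSup₂_le fun P hP => ?_)
  simp only [if_true] at hP
  rw [ENNReal.le_div_iff_mul_le (by simp [hc]) (by simp), mul_comm, Finset.mul_sum]
  calc ∑ b ∈ P, (c : ℝ≥0∞) * ENNReal.ofReal ((2 * b.2) ^ (u : ℝ))
      ≤ ∑ b ∈ P, ν (Metric.closedBall b.1 b.2) := by
        refine Finset.sum_le_sum fun b hb => ?_
        obtain ⟨hbA, hb0, hbδ⟩ := hP.1 b hb
        refine le_trans ?_ (h b.1 hbA b.2 hb0 (hbδ.trans (min_le_left _ _)))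
        refine mul_le_mul_right (ENNReal.ofReal_le_ofReal ?_) _
        refine Real.rpow_le_rpow_of_exponent_ge (by positivity) ?_ (by exact_mod_cast hsu'.le)
        linarith [hbδ.trans (min_le_right _ _)]
    _ = ν (⋃ b ∈ P, Metric.closedBall b.1 b.2) :=
        (measure_biUnion_finset hP.2 fun b _ => Metric.isClosed_closedBall.measurableSet).symm
    _ ≤ ν Set.univ := measure_mono (Set.subset_univ _)

end Packing

/-! ### Ternary expansions -/

theorem ternary_mem_Icc (t : ℕ → Fin 3) : ternary t ∈ Set.Icc (0 : ℝ) 1 := by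
  rw [ternary_eq_ofDigits]
  exact ⟨Real.ofDigits_nonneg t, Real.ofDigits_le_one t⟩

theorem abs_ternary_sub_le {t u : ℕ → Fin 3} {m : ℕ} (h : ∀ k < m, t k = u k) :
    |ternary t - ternary u| ≤ ((3 : ℝ) ^ m)⁻¹ := by
  rw [ternary_eq_ofDigits, ternary_eq_ofDigits]
  simpa using Real.abs_ofDigits_sub_ofDigits_le h

theorem continuous_ternary : Continuous ternary := by
  rw [funext ternary_eq_ofDigits]
  exact Real.continuous_ofDigits

/-- The natural number whose ternary digits are `t 0, …, t (m - 1)`, most significant first: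
the position of `ternary t` among the triadic intervals of length `3 ^ (-m)`. -/
def prefixNum (t : ℕ → Fin 3) : ℕ → ℕ
  | 0 => 0
  | m + 1 => 3 * prefixNum t m + t m

theorem eq_of_prefixNum_eq {t u : ℕ → Fin 3} {m : ℕ} (h : prefixNum t m = prefixNum u m) :
    ∀ k < m, t k = u k := by
  induction m with
  | zero => intro k hk; omega
  | succ m ih =>
    simp only [prefixNum] at h
    have h1 := (t m).isLt
    have h2 := (u m).isLt
    intro k hk
    rcases Nat.lt_succ_iff_lt_or_eq.1 hk with hk | rfl
    · exact ih (by omega) k hk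
    · exact Fin.ext (by omega)

theorem pow_mul_ternary (t : ℕ → Fin 3) (m : ℕ) :
    3 ^ m * ternary t = prefixNum t m + ternary (fun k => t (k + m)) := by
  induction m with
  | zero => simp [prefixNum]
  | succ m ih =>
    have h := ternary_split (fun k => t (k + m)) 0
    simp only [Finset.range_zero, Finset.sum_empty, zero_add, pow_one] at h
    rw [pow_succ, mul_comm _ (3 : ℝ), mul_assoc, ih, h, prefixNum]
    simp only [show ∀ k, k + 1 + m = k + (m + 1) from fun k => by ring]
    push_cast
    ring

theorem abs_prefixNum_sub_le {t u : ℕ → Fin 3} {m : ℕ}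
    (h : |ternary t - ternary u| ≤ ((3 : ℝ) ^ m)⁻¹) :
    |(prefixNum t m : ℤ) - prefixNum u m| ≤ 2 := by
  have h3 : (0 : ℝ) < 3 ^ m := by positivity
  have h1 : |(3 : ℝ) ^ m * ternary t - 3 ^ m * ternary u| ≤ 1 := by
    rw [← mul_sub, abs_mul, abs_of_pos h3]
    calc _ ≤ (3 : ℝ) ^ m * (3 ^ m)⁻¹ := by gcongr
      _ = 1 := mul_inv_cancel₀ h3.ne'
  rw [pow_mul_ternary, pow_mul_ternary] at h1
  have ht := ternary_mem_Icc fun k => t (k + m)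
  have hu := ternary_mem_Icc fun k => u (k + m)
  have : |(prefixNum t m : ℝ) - prefixNum u m| ≤ 2 := by
    rw [abs_le] at h1 ⊢
    constructor <;> linarith [h1.1, h1.2, ht.1, ht.2, hu.1, hu.2]
  exact_mod_cast this

/-! ### The coordinates are nowhere Hölder continuous of order larger than `1 / n` -/

theorem xi_iterate_injective (m : ℕ) : Function.Injective xi^[m] :=
  Function.Injective.iterate (by decide) m

theorem digitSum_congr {n : ℕ} (i : Fin n) (j : ℕ) {t u : ℕ → Fin 3}
    (h : ∀ k < i + j * n, k % n ≠ i → t k = u k) : digitSum n i j t = digitSum n i j u := by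
  rw [digitSum_eq, digitSum_eq]
  refine Finset.sum_congr rfl fun k hk => ?_
  simp only [Finset.mem_filter, Finset.mem_range] at hk
  rw [h k hk.1 hk.2]

theorem row_mod {n : ℕ} (i : Fin n) (j : ℕ) : (i + j * n) % n = i := by
  simp [Nat.mod_eq_of_lt i.isLt]

/-- Digits of row `i` do not enter the sign of any digit of the `i`-th coordinate. Changing one of
them therefore changes a single digit of the coordinate, and moves the argument by at most
`3 ^ (-k * n)` while the coordinate moves by at least `3 ^ (-(k + 1))`. -/
theorem exists_near_far {n : ℕ} (i : Fin n) {a : ℝ} (ha : a ∈ Set.Icc (0 : ℝ) 1) (k : ℕ) :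
    ∃ b ∈ Set.Icc (0 : ℝ) 1, |a - b| ≤ ((3 : ℝ) ^ (k * n))⁻¹ ∧
      ((3 : ℝ) ^ (k + 1))⁻¹ ≤ |coord n i a - coord n i b| := by
  obtain ⟨t, rfl⟩ := exists_ternary ha
  obtain ⟨d, hd⟩ := exists_ne (t (i + k * n))
  set u := Function.update t (i + k * n) d with hu
  have hn : 0 < n := i.pos
  have hS : ∀ j, digitSum n i j t = digitSum n i j u := fun j =>
    digitSum_congr i j fun m _ hm => by
      rw [hu, Function.update_of_ne]
      rintro rfl
      exact hm (row_mod i k)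
  have hne : ∀ j, j ≠ k → coordDigit n i t j = coordDigit n i u j := by
    intro j hj
    have : (i : ℕ) + j * n ≠ i + k * n := fun h =>
      hj (Nat.eq_of_mul_eq_mul_right hn (Nat.add_left_cancel h))
    rw [coordDigit, coordDigit, ← hS, hu, Function.update_of_ne this]
  have hk : coordDigit n i t k ≠ coordDigit n i u k := by
    rw [coordDigit, coordDigit, ← hS, hu, Function.update_self]
    exact fun h => hd (xi_iterate_injective _ h).symm
  refine ⟨ternary u, ternary_mem_Icc u, abs_ternary_sub_le fun m hm => ?_, ?_⟩
  · rw [hu, Function.update_of_ne (by omega)]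
  · rw [coord_ternary, coord_ternary, coordSeq_eq_ternary, coordSeq_eq_ternary,
      ternary_split _ k, ternary_split (coordDigit n i u) k,
      Finset.sum_congr rfl (fun j hj => by rw [hne j (Finset.mem_range.1 hj).ne]),
      funext fun j => hne (j + (k + 1)) (by omega), add_sub_add_left_eq_sub, ← sub_div,
      add_sub_add_right_eq_sub, abs_div, abs_of_pos (by positivity : (0 : ℝ) < 3 ^ (k + 1)),
      inv_eq_one_div]
    gcongr
    have : (1 : ℤ) ≤ |((coordDigit n i t k : ℕ) : ℤ) - (coordDigit n i u k : ℕ)| := by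
      refine Int.one_le_abs (sub_ne_zero.2 fun h => hk (Fin.ext ?_))
      exact_mod_cast h
    exact_mod_cast this

theorem not_isHolderAt_coord {n : ℕ} (i : Fin n) {q : ℝ} (hq : 1 / (n : ℝ) < q) {a : ℝ}
    (ha : a ∈ Set.Icc (0 : ℝ) 1) : ¬ IsHolderAt (coord n i) (Set.Icc 0 1) q a := by
  rintro ⟨C, hC, δ, hδ, h⟩
  have hn : 0 < n := i.pos
  have hn' : (0 : ℝ) < n := by exact_mod_cast hn
  have hq0 : 0 < q := lt_trans (by positivity) hq
  have hqn : 1 - n * q < 0 := by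
    rw [div_lt_iff₀ hn'] at hq; linarith
  -- along the points of `exists_near_far` the difference quotient of order `q` grows like `ρ⁻ᵏ`
  set ρ : ℝ := (3 : ℝ) ^ (1 - n * q) with hρ
  have hρ1 : ρ < 1 := Real.rpow_lt_one_of_one_lt_of_neg (by norm_num) hqn
  have hρ0 : 0 < ρ := by positivity
  have h1 : Tendsto (fun k : ℕ => ((3 : ℝ) ^ (k * n))⁻¹) atTop (𝓝 0) := by
    have : Tendsto (fun k : ℕ => (((3 : ℝ) ^ n)⁻¹) ^ k) atTop (𝓝 0) :=
      tendsto_pow_atTop_nhds_zero_of_lt_one (by positivity)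
        (inv_lt_one_of_one_lt₀ (one_lt_pow₀ (by norm_num) hn.ne'))
    simpa only [inv_pow, ← pow_mul, mul_comm n] using this
  have h2 : Tendsto (fun k : ℕ => 3 * C * ρ ^ k) atTop (𝓝 0) := by
    simpa using (tendsto_pow_atTop_nhds_zero_of_lt_one hρ0.le hρ1).const_mul (3 * C)
  obtain ⟨k, hk1, hk2⟩ := ((h1.eventually_lt_const hδ).and (h2.eventually_lt_const one_pos)).exists
  obtain ⟨b, hb, hab, hfab⟩ := exists_near_far i ha k
  have h3 := hfab.trans (h b hb (hab.trans_lt hk1))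
  have h4 : |a - b| ^ q ≤ ((3 : ℝ) ^ (k * n))⁻¹ ^ q :=
    Real.rpow_le_rpow (abs_nonneg _) hab hq0.le
  have h5 : ((3 : ℝ) ^ (k * n))⁻¹ ^ q = ρ ^ k * (3 ^ k)⁻¹ := by
    rw [hρ, ← Real.rpow_natCast, ← Real.rpow_natCast 3 k, ← Real.rpow_natCast _ k,
      ← Real.rpow_neg (by norm_num), ← Real.rpow_neg (by norm_num),
      ← Real.rpow_mul (by norm_num), ← Real.rpow_mul (by norm_num), ← Real.rpow_add (by norm_num)]
    congr 1
    push_cast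
    ring
  have h6 : ((3 : ℝ) ^ (k + 1))⁻¹ ≤ C * (ρ ^ k * (3 ^ k)⁻¹) := by
    rw [← h5]; exact h3.trans (by gcongr)
  have h7 : (0 : ℝ) < 3 ^ k := by positivity
  rw [pow_succ, mul_inv] at h6
  have h8 : (3 : ℝ)⁻¹ * (3 ^ k)⁻¹ ≤ (C * ρ ^ k) * (3 ^ k)⁻¹ := by linarith
  have h9 := le_of_mul_le_mul_right h8 (by positivity)
  linarith

theorem IsHolderAt.of_differentiableWithinAt {f : ℝ → ℝ} {I : Set ℝ} {a : ℝ}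
    (h : DifferentiableWithinAt ℝ f I a) : IsHolderAt f I 1 a := by
  obtain ⟨C, hC, hb⟩ := h.isBigO_sub.exists_pos
  rw [Asymptotics.isBigOWith_iff, eventually_nhdsWithin_iff, Metric.eventually_nhds_iff] at hb
  obtain ⟨δ, hδ, hb⟩ := hb
  refine ⟨C, hC, δ, hδ, fun b hbI hab => ?_⟩
  have := hb (y := b) (by rwa [dist_comm, Real.dist_eq]) hbI
  rwa [Real.rpow_one, abs_sub_comm (f a), abs_sub_comm a]

/-! ### Parametrization of the graph by independent digits -/

/-- The sequence obtained from `y` by applying to the digits of row `i` the power of `ξ` that occurs in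
the `i`-th coordinate. Since this power depends on the other rows only, `twist n i` is an involution. -/
def twist (n : ℕ) (i : Fin n) (y : ℕ → Fin 3) (k : ℕ) : Fin 3 :=
  if k % n = i then coordDigit n i y (k / n) else y k

/-- The digits of `y` in row `i`. -/
def row (n : ℕ) (i : Fin n) (y : ℕ → Fin 3) (j : ℕ) : Fin 3 := y (i + j * n)

theorem coordDigit_twist {n : ℕ} (i : Fin n) (y : ℕ → Fin 3) :
    coordDigit n i (twist n i y) = row n i y := by
  funext j
  have hS : digitSum n i j (twist n i y) = digitSum n i j y :=
    digitSum_congr i j fun k _ hk => if_neg hk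
  have hdiv : (i + j * n) / n = j := by
    rw [Nat.add_mul_div_right _ _ i.pos, Nat.div_eq_of_lt i.isLt, zero_add]
  have hxi : xi^[2] = id := by decide
  rw [coordDigit, hS, twist, if_pos (row_mod i j), hdiv, coordDigit, row,
    ← Function.iterate_add_apply, ← two_mul, Function.iterate_mul, hxi,
    Function.iterate_id, id]

theorem twist_twist {n : ℕ} (i : Fin n) (y : ℕ → Fin 3) : twist n i (twist n i y) = y := by
  funext k
  rw [twist]
  split_ifs with hk
  · rw [coordDigit_twist, row, ← hk, Nat.mod_add_div']
  · rw [twist, if_neg hk]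

theorem twist_congr {n : ℕ} (i : Fin n) {y z : ℕ → Fin 3} {m : ℕ} (h : ∀ k < m, y k = z k) :
    ∀ k < m, twist n i y k = twist n i z k := by
  intro k hk
  rw [twist, twist]
  split_ifs with hi
  · have hki : (i : ℕ) + k / n * n = k := by rw [← hi, Nat.mod_add_div']
    rw [coordDigit, coordDigit, hki, h k hk,
      digitSum_congr i (k / n) fun l hl _ => h l (by omega)]
  · exact h k hk

/-- The point of the graph of `x_i` whose argument has the digits `twist n i y`. Its second coordinate
is the number whose digits are those of row `i` of `y`, without any change of sign. -/
noncomputable def graphPoint (n : ℕ) (i : Fin n) (y : ℕ → Fin 3) : EuclideanSpace ℝ (Fin 2) :=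
  !₂[ternary (twist n i y), ternary (row n i y)]

theorem range_graphPoint {n : ℕ} (i : Fin n) :
    Set.range (graphPoint n i) = graph (coord n i) (Set.Icc 0 1) := by
  ext x
  constructor
  · rintro ⟨y, rfl⟩
    refine ⟨ternary (twist n i y), ternary_mem_Icc _, ?_⟩
    simp only [graphPoint, coord_ternary, coordSeq_eq_ternary, coordDigit_twist]
  · rintro ⟨a, ha, rfl⟩
    obtain ⟨t, rfl⟩ := exists_ternary ha
    refine ⟨twist n i t, ?_⟩
    simp only [graphPoint, coord_ternary, coordSeq_eq_ternary, ← coordDigit_twist, twist_twist]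

theorem continuous_twist {n : ℕ} (i : Fin n) : Continuous (twist n i) := by
  refine continuous_pi fun k => ?_
  unfold twist
  split_ifs with h
  · have hS : Continuous fun y : ℕ → Fin 3 => digitSum n i (k / n) y := by
      simp only [digitSum_eq]
      exact continuous_finsetSum _ fun l _ =>
        (continuous_of_discreteTopology (f := fun a : Fin 3 => (a : ℕ))).comp (continuous_apply l)
    exact (continuous_of_discreteTopology (f := fun p : ℕ × Fin 3 => xi^[p.1] p.2)).comp
      (hS.prodMk (continuous_apply _))
  · exact continuous_apply k

theorem continuous_graphPoint {n : ℕ} (i : Fin n) : Continuous (graphPoint n i) := by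
  refine (PiLp.continuous_toLp 2 _).comp (continuous_pi fun l => ?_)
  fin_cases l
  · exact continuous_ternary.comp (continuous_twist i)
  · exact continuous_ternary.comp (continuous_pi fun j => continuous_apply _)

theorem dist_graphPoint_le {n : ℕ} (i : Fin n) (y z : ℕ → Fin 3) :
    dist (graphPoint n i y) (graphPoint n i z) ≤
      |ternary (twist n i y) - ternary (twist n i z)| +
        |ternary (row n i y) - ternary (row n i z)| := by
  rw [EuclideanSpace.dist_eq, Fin.sum_univ_two]
  refine Real.sqrt_le_iff.2 ⟨by positivity, ?_⟩
  simp only [graphPoint, Real.dist_eq, Matrix.cons_val_zero, Matrix.cons_val_one]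
  nlinarith [abs_nonneg (ternary (twist n i y) - ternary (twist n i z)),
    abs_nonneg (ternary (row n i y) - ternary (row n i z))]

theorem abs_sub_le_dist_graphPoint {n : ℕ} (i : Fin n) (y z : ℕ → Fin 3) :
    |ternary (twist n i y) - ternary (twist n i z)| ≤ dist (graphPoint n i y) (graphPoint n i z) ∧
      |ternary (row n i y) - ternary (row n i z)| ≤
        dist (graphPoint n i y) (graphPoint n i z) := by
  have h := fun l : Fin 2 => PiLp.norm_apply_le (graphPoint n i y - graphPoint n i z) l
  rw [dist_eq_norm]
  exact ⟨by simpa [graphPoint] using h 0, by simpa [graphPoint] using h 1⟩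

/-! ### The natural measure on the graph -/

/-- The law of a sequence of independent, uniformly distributed ternary digits. -/
noncomputable def digitMeasure : Measure (ℕ → Fin 3) :=
  Measure.infinitePi fun _ => (PMF.uniformOfFintype (Fin 3)).toMeasure

instance : IsProbabilityMeasure digitMeasure := by
  unfold digitMeasure; infer_instance

/-- The digits that determine a point of the graph up to an error of order `3 ^ (-k * n)`: the first
`k * n` digits of the argument, `k` of which lie in row `i`, and the first `k * n` digits of row `i`. -/
def levelDigits (n : ℕ) (i : Fin n) (k : ℕ) : Finset ℕ :=
  Finset.range (k * n) ∪ (Finset.Ico k (k * n)).image fun j => i + j * n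

theorem card_levelDigits {n : ℕ} (i : Fin n) (k : ℕ) :
    (levelDigits n i k).card = k * n + (k * n - k) := by
  have hn : 0 < n := i.pos
  rw [levelDigits, Finset.card_union_of_disjoint, Finset.card_range, Finset.card_image_of_injective,
    Nat.card_Ico]
  · intro a b hab
    exact Nat.eq_of_mul_eq_mul_right hn (by simpa using hab)
  · rw [Finset.disjoint_left]
    intro l hl hl'
    obtain ⟨j, hj, rfl⟩ := Finset.mem_image.1 hl'
    have : k * n ≤ j * n := Nat.mul_le_mul_right n (Finset.mem_Ico.1 hj).1
    have := Finset.mem_range.1 hl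
    omega

/-- The sequences that agree with `y` in the digits of `levelDigits n i k`. -/
def levelCylinder (n : ℕ) (i : Fin n) (k : ℕ) (y : ℕ → Fin 3) : Set (ℕ → Fin 3) :=
  Set.pi (levelDigits n i k) fun l => {y l}

theorem mem_levelCylinder {n : ℕ} {i : Fin n} {k : ℕ} {y z : ℕ → Fin 3} :
    z ∈ levelCylinder n i k y ↔
      (∀ l < k * n, z l = y l) ∧ ∀ j < k * n, row n i z j = row n i y j := by
  simp only [levelCylinder, levelDigits, Set.mem_pi, Finset.coe_union, Finset.coe_range,
    Finset.coe_image, Finset.coe_Ico, Set.mem_union, Set.mem_Iio, Set.mem_image, Set.mem_Ico,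
    Set.mem_singleton_iff]
  constructor
  · intro h
    refine ⟨fun l hl => h l (Or.inl hl), fun j hj => h _ ?_⟩
    by_cases hjk : k ≤ j
    · exact Or.inr ⟨j, ⟨hjk, hj⟩, rfl⟩
    · left
      have : (j + 1) * n ≤ k * n := Nat.mul_le_mul_right n (by omega)
      have := i.isLt
      rw [add_mul] at *
      omega
  · rintro ⟨h1, h2⟩ l (hl | ⟨j, hj, rfl⟩)
    · exact h1 l hl
    · exact h2 j hj.2

/-- The mass of a cylinder of level `k` is the power `2 - 1 / n` of the scale `3 ^ (-k * n)`. -/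
theorem digitMeasure_levelCylinder {n : ℕ} (i : Fin n) (k : ℕ) (y : ℕ → Fin 3) :
    digitMeasure (levelCylinder n i k y) =
      ENNReal.ofReal ((((3 : ℝ) ^ n)⁻¹ ^ k) ^ (2 - 1 / (n : ℝ))) := by
  have hn : (n : ℝ) ≠ 0 := by exact_mod_cast i.pos.ne'
  have h1 : ∀ a : Fin 3, (PMF.uniformOfFintype (Fin 3)).toMeasure {a} = ENNReal.ofReal 3⁻¹ := by
    intro a
    rw [PMF.toMeasure_apply_singleton _ _ (measurableSet_singleton a),
      PMF.uniformOfFintype_apply, Fintype.card_fin, ENNReal.ofReal_inv_of_pos (by norm_num)]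
    simp
  rw [digitMeasure, levelCylinder, Measure.infinitePi_pi _ fun l _ => measurableSet_singleton _]
  simp only [h1, Finset.prod_const, card_levelDigits]
  rw [← ENNReal.ofReal_pow (by norm_num)]
  congr 1
  have hk : k ≤ k * n := Nat.le_mul_of_pos_right k i.pos
  rw [inv_pow, ← Real.rpow_natCast, ← Real.rpow_neg (by norm_num), inv_pow, ← pow_mul,
    ← Real.rpow_natCast, ← Real.rpow_neg (by norm_num), ← Real.rpow_mul (by norm_num)]
  congr 1
  push_cast [Nat.cast_sub hk]
  field_simp
  ring

/-- Two points of the graph in the same cylinder are close. -/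
theorem levelCylinder_subset_closedBall {n : ℕ} (i : Fin n) (k : ℕ) (y : ℕ → Fin 3) {r : ℝ}
    (hr : 2 * ((3 : ℝ) ^ n)⁻¹ ^ k ≤ r) :
    levelCylinder n i k y ⊆ graphPoint n i ⁻¹' Metric.closedBall (graphPoint n i y) r := by
  intro z hz
  rw [mem_levelCylinder] at hz
  rw [Set.mem_preimage, Metric.mem_closedBall]
  refine (dist_graphPoint_le i z y).trans (le_trans ?_ hr)
  have h1 := abs_ternary_sub_le (twist_congr i hz.1)
  have h2 := abs_ternary_sub_le hz.2
  rw [inv_pow, ← pow_mul, mul_comm n]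
  linarith

/-- A set of diameter at most `3 ^ (-k * n)` meets at most `5 * 5` pieces of the graph that come from
cylinders of level `k`. -/
theorem digitMeasure_preimage_le {n : ℕ} (i : Fin n) (k : ℕ) {U : Set (EuclideanSpace ℝ (Fin 2))}
    (hU : Metric.ediam U ≤ ENNReal.ofReal (((3 : ℝ) ^ n)⁻¹ ^ k)) :
    digitMeasure (graphPoint n i ⁻¹' U) ≤
      25 * ENNReal.ofReal ((((3 : ℝ) ^ n)⁻¹ ^ k) ^ (2 - 1 / (n : ℝ))) := by
  rcases (graphPoint n i ⁻¹' U).eq_empty_or_nonempty with h0 | ⟨y, hy⟩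
  · simp [h0]
  let N : (ℕ → Fin 3) → ℤ × ℤ := fun z =>
    (prefixNum (twist n i z) (k * n), prefixNum (row n i z) (k * n))
  let F : Finset (ℤ × ℤ) :=
    Finset.Icc ((N y).1 - 2) ((N y).1 + 2) ×ˢ Finset.Icc ((N y).2 - 2) ((N y).2 + 2)
  have hF : F.card = 25 := by
    simp only [F, Finset.card_product, Int.card_Icc]
    rw [show (N y).1 + 2 + 1 - ((N y).1 - 2) = 5 by ring,
      show (N y).2 + 2 + 1 - ((N y).2 - 2) = 5 by ring]
    rfl
  have hcover : graphPoint n i ⁻¹' U ⊆ ⋃ p ∈ F, N ⁻¹' {p} := by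
    intro z hz
    have hd : dist (graphPoint n i z) (graphPoint n i y) ≤ ((3 : ℝ) ^ (k * n))⁻¹ := by
      have := (Metric.edist_le_ediam_of_mem (Set.mem_preimage.1 hz)
        (Set.mem_preimage.1 hy)).trans hU
      rwa [edist_dist, ENNReal.ofReal_le_ofReal_iff (by positivity), inv_pow, ← pow_mul,
        mul_comm n] at this
    have hz' := abs_sub_le_dist_graphPoint i z y
    have h1 := abs_le.1 (abs_prefixNum_sub_le (hz'.1.trans hd))
    have h2 := abs_le.1 (abs_prefixNum_sub_le (hz'.2.trans hd))
    refine Set.mem_biUnion (x := N z) ?_ rfl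
    simp only [F, Finset.coe_product, Finset.coe_Icc, Set.mem_prod, Set.mem_Icc, N]
    omega
  have hfiber : ∀ p, digitMeasure (N ⁻¹' {p}) ≤
      ENNReal.ofReal ((((3 : ℝ) ^ n)⁻¹ ^ k) ^ (2 - 1 / (n : ℝ))) := by
    intro p
    rcases (N ⁻¹' {p}).eq_empty_or_nonempty with h0 | ⟨w, rfl⟩
    · simp [h0]
    · rw [← digitMeasure_levelCylinder i k w]
      refine measure_mono fun z hz => ?_
      have hz' : N z = N w := hz
      simp only [N, Prod.mk.injEq, Nat.cast_inj] at hz'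
      refine mem_levelCylinder.2 ⟨fun l hl => ?_, eq_of_prefixNum_eq hz'.2⟩
      have := twist_congr i (eq_of_prefixNum_eq hz'.1) l hl
      rwa [twist_twist, twist_twist] at this
  calc digitMeasure (graphPoint n i ⁻¹' U) ≤ digitMeasure (⋃ p ∈ F, N ⁻¹' {p}) :=
        measure_mono hcover
    _ ≤ ∑ p ∈ F, digitMeasure (N ⁻¹' {p}) := measure_biUnion_finset_le _ _
    _ ≤ ∑ _p ∈ F, ENNReal.ofReal ((((3 : ℝ) ^ n)⁻¹ ^ k) ^ (2 - 1 / (n : ℝ))) :=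
        Finset.sum_le_sum fun p _ => hfiber p
    _ = _ := by rw [Finset.sum_const, hF, nsmul_eq_mul]; rfl

/-- The image of `digitMeasure` on the graph. -/
noncomputable def graphMeasure (n : ℕ) (i : Fin n) : Measure (EuclideanSpace ℝ (Fin 2)) :=
  digitMeasure.map (graphPoint n i)

instance {n : ℕ} (i : Fin n) : IsProbabilityMeasure (graphMeasure n i) :=
  Measure.isProbabilityMeasure_map (continuous_graphPoint i).measurable.aemeasurable

theorem graphMeasure_graph {n : ℕ} (i : Fin n) :
    graphMeasure n i (graph (coord n i) (Set.Icc 0 1)) = 1 := by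
  rw [← range_graphPoint, graphMeasure, Measure.map_apply (continuous_graphPoint i).measurable
    (isCompact_range (continuous_graphPoint i)).measurableSet]
  simp

/-! ### The dimensions of the graph -/

theorem inv_three_pow_lt_one {n : ℕ} (hn : 0 < n) : ((3 : ℝ) ^ n)⁻¹ < 1 :=
  inv_lt_one_of_one_lt₀ (one_lt_pow₀ (by norm_num) hn.ne')

theorem graphMeasure_le {n : ℕ} (i : Fin n) {s : ℝ≥0} (hs : (s : ℝ) = 2 - 1 / n) (hs0 : 0 < s)
    {U : Set (EuclideanSpace ℝ (Fin 2))} (hU : Metric.ediam U ≤ 1) :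
    graphMeasure n i U ≤ ENNReal.ofReal (25 * ((3 : ℝ) ^ n) ^ (s : ℝ)) * Metric.ediam U ^ (s : ℝ) := by
  set ρ : ℝ := ((3 : ℝ) ^ n)⁻¹ with hρ
  have hρ0 : 0 < ρ := by positivity
  have hρ1 : ρ < 1 := inv_three_pow_lt_one i.pos
  have hscale : ∀ k, Metric.ediam U ≤ ENNReal.ofReal (ρ ^ k) →
      graphMeasure n i U ≤ ENNReal.ofReal (25 * (ρ ^ k) ^ (s : ℝ)) := by
    intro k hk
    refine (measure_mono subset_closure).trans ?_
    rw [graphMeasure, Measure.map_apply (continuous_graphPoint i).measurable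
      isClosed_closure.measurableSet, ENNReal.ofReal_mul (by norm_num), hs]
    refine (digitMeasure_preimage_le i k (by rwa [Metric.ediam_closure])).trans (le_of_eq ?_)
    rw [ENNReal.ofReal_ofNat]
  have hfin : Metric.ediam U ≠ ∞ := ne_top_of_le_ne_top ENNReal.one_ne_top hU
  rcases eq_or_ne (Metric.ediam U) 0 with h0 | h0
  · refine le_trans ?_ zero_le
    have hlim : Tendsto (fun k => ENNReal.ofReal (25 * (ρ ^ k) ^ (s : ℝ))) atTop (𝓝 0) := by
      have h1 := (tendsto_pow_atTop_nhds_zero_of_lt_one hρ0.le hρ1).rpow_const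
        (p := (s : ℝ)) (Or.inr s.2)
      rw [Real.zero_rpow (by exact_mod_cast hs0.ne')] at h1
      simpa using ENNReal.tendsto_ofReal (h1.const_mul 25)
    exact ge_of_tendsto' hlim fun k => hscale k (by simp [h0])
  · set r := (Metric.ediam U).toReal with hr
    have hr0 : 0 < r := ENNReal.toReal_pos h0 hfin
    have hUr : Metric.ediam U = ENNReal.ofReal r := (ENNReal.ofReal_toReal hfin).symm
    have hr1 : r ≤ 1 := by simpa using ENNReal.toReal_mono ENNReal.one_ne_top hU
    obtain ⟨k, hk1, hk2⟩ := exists_nat_pow_near_of_lt_one hr0 hr1 hρ0 hρ1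
    refine (hscale k (by rw [hUr]; exact ENNReal.ofReal_le_ofReal hk2)).trans ?_
    rw [hUr, ENNReal.ofReal_rpow_of_nonneg hr0.le s.coe_nonneg, ← ENNReal.ofReal_mul (by positivity),
      mul_assoc, ← Real.mul_rpow (by positivity) hr0.le]
    refine ENNReal.ofReal_le_ofReal ?_
    gcongr
    have : ρ ^ k = 3 ^ n * ρ ^ (k + 1) := by
      rw [pow_succ, hρ]; field_simp
    rw [this]
    gcongr

theorem le_graphMeasure_closedBall {n : ℕ} (i : Fin n) {s : ℝ≥0} (hs : (s : ℝ) = 2 - 1 / n)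
    {x : EuclideanSpace ℝ (Fin 2)} (hx : x ∈ graph (coord n i) (Set.Icc 0 1)) {r : ℝ} (hr : 0 < r)
    (hr1 : r ≤ 1) :
    ENNReal.ofReal ((((3 : ℝ) ^ n)⁻¹ / 4) ^ (s : ℝ)) * ENNReal.ofReal ((2 * r) ^ (s : ℝ)) ≤
      graphMeasure n i (Metric.closedBall x r) := by
  rw [← range_graphPoint] at hx
  obtain ⟨y, rfl⟩ := hx
  set ρ : ℝ := ((3 : ℝ) ^ n)⁻¹ with hρ
  have hρ0 : 0 < ρ := by positivity
  obtain ⟨k, hk1, hk2⟩ := exists_nat_pow_near_of_lt_one (x := r / 2) (by positivity) (by linarith)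
    hρ0 (inv_three_pow_lt_one i.pos)
  rw [graphMeasure, Measure.map_apply (continuous_graphPoint i).measurable
    Metric.isClosed_closedBall.measurableSet]
  refine le_trans ?_ (measure_mono (levelCylinder_subset_closedBall i (k + 1) y (by linarith)))
  rw [digitMeasure_levelCylinder, ← hs, ← hρ, ← ENNReal.ofReal_mul (by positivity),
    ← Real.mul_rpow (by positivity) (by positivity)]
  refine ENNReal.ofReal_le_ofReal (Real.rpow_le_rpow (by positivity) ?_ s.2)
  rw [pow_succ]
  nlinarith

theorem le_dimH_graph {n : ℕ} (i : Fin n) {s : ℝ≥0} (hs : (s : ℝ) = 2 - 1 / n) (hs0 : 0 < s) :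
    (s : ℝ≥0∞) ≤ dimH (graph (coord n i) (Set.Icc 0 1)) := by
  set C := ENNReal.ofReal (25 * ((3 : ℝ) ^ n) ^ (s : ℝ)) with hC
  have hC0 : C ≠ 0 := by
    rw [hC, Ne, ENNReal.ofReal_eq_zero, not_le]; positivity
  have hle : C⁻¹ • graphMeasure n i ≤ μH[s] := by
    refine Measure.le_hausdorffMeasure _ _ 1 one_pos fun U hU => ?_
    rw [Measure.smul_apply, smul_eq_mul, mul_comm, ← div_eq_mul_inv,
      ENNReal.div_le_iff hC0 ENNReal.ofReal_ne_top, mul_comm]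
    exact graphMeasure_le i hs hs0 hU
  refine le_dimH_of_hausdorffMeasure_ne_zero fun h => ?_
  have := hle (graph (coord n i) (Set.Icc 0 1))
  rw [h, Measure.smul_apply, graphMeasure_graph, smul_eq_mul, mul_one, nonpos_iff_eq_zero,
    ENNReal.inv_eq_zero] at this
  exact ENNReal.ofReal_ne_top this

theorem packingDim_graph_le {n : ℕ} (i : Fin n) {s : ℝ≥0} (hs : (s : ℝ) = 2 - 1 / n) :
    packingDim (graph (coord n i) (Set.Icc 0 1)) ≤ s := by
  refine packingDim_le_of_le_measure_closedBall (graphMeasure n i) _ s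
    (Real.toNNReal ((((3 : ℝ) ^ n)⁻¹ / 4) ^ (s : ℝ))) ?_ one_pos
    fun x hx r hr hr1 => le_graphMeasure_closedBall i hs hx hr hr1
  rw [Ne, Real.toNNReal_eq_zero, not_le]
  positivity

end PeanoCurve

theorem mainTheorem6 (n : ℕ) (hn : 2 ≤ n) (i : Fin n) :
    (∀ q : ℝ, 1 / (n : ℝ) < q → ∀ a ∈ Set.Icc (0 : ℝ) 1,
      ¬ PeanoCurve.IsHolderAt (PeanoCurve.coord n i) (Set.Icc 0 1) q a) ∧
    (∀ a ∈ Set.Icc (0 : ℝ) 1,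
      ¬ DifferentiableWithinAt ℝ (PeanoCurve.coord n i) (Set.Icc 0 1) a) ∧
    dimH (PeanoCurve.graph (PeanoCurve.coord n i) (Set.Icc 0 1)) =
      ENNReal.ofReal (2 - 1 / (n : ℝ)) ∧
    PeanoCurve.packingDim (PeanoCurve.graph (PeanoCurve.coord n i) (Set.Icc 0 1)) =
      ENNReal.ofReal (2 - 1 / (n : ℝ)) := by
  have hn1 : 1 / (n : ℝ) < 1 := by
    rw [div_lt_one (by positivity)]
    exact_mod_cast hn
  have hs : (((2 - 1 / (n : ℝ)).toNNReal : ℝ≥0) : ℝ) = 2 - 1 / n :=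
    Real.coe_toNNReal _ (by linarith)
  have hs0 : 0 < (2 - 1 / (n : ℝ)).toNNReal := Real.toNNReal_pos.2 (by linarith)
  have h1 := PeanoCurve.le_dimH_graph i hs hs0
  have h2 := PeanoCurve.dimH_le_packingDim (PeanoCurve.graph (PeanoCurve.coord n i) (Set.Icc 0 1))
  have h3 := PeanoCurve.packingDim_graph_le i hs
  exact ⟨fun q hq a ha => PeanoCurve.not_isHolderAt_coord i hq ha,
    fun a ha hd => PeanoCurve.not_isHolderAt_coord i hn1 ha
      (PeanoCurve.IsHolderAt.of_differentiableWithinAt hd),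
    le_antisymm (h2.trans h3) h1, le_antisymm h3 (h1.trans h2)⟩
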